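/- Let $\mathcal G$ be a weighted signed digraph on a finite node set $V$ with adjacency weight matrix $A=[a_{ij}]\in\mathbb R^{V\times V}$, $a_{ii}=0$, where there is an edge from $j$ to $i$ exactly when $a_{ij}\neq 0$, and let $L=[l_{ij}]$ be its Laplacian: $l_{ii}=\sum_{k}|a_{ik}|$ and $l_{ij}=-a_{ij}$ for $j\ne i$. A node is rooted if there is a directed path from it to every other node. Assume that $\mathcal G$ is quasi-strongly connected, i.e. the set $V_{\mathrm r}$ of rooted nodes is non-empty; put $V_{\mathrm{nr}}=V\setminus V_{\mathrm r}$. A rooted cycle is a directed cycle $v_{k_0}\to v_{k_1}\to\dots\to v_{k_{l-1}}\to v_{k_0}$ ($l\ge 2$, with $v_{k_0},\dots,v_{k_{l-1}}$ distinct) all of whose nodes are rooted; it is positive (negative) if the product $a_{k_1k_0}a_{k_2k_1}\cdots a_{k_0k_{l-1}}$ of its edge weights is positive (negative). Consider the conditions C1) $\mathcal G$ has no rooted cycles; C2) all rooted cycles of $\mathcal G$ are positive; C3) at least one rooted cycle of $\mathcal G$ is negative. Let $L_{\mathrm r}$ and $L_{\mathrm{nr}}$ be the Laplacians of the subgraphs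 induced on $V_{\mathrm r}$ and $V_{\mathrm{nr}}$, let $\overline L_{\mathrm r}$ be the Laplacian of the digraph on $V_{\mathrm r}$ with weights $|a_{ij}|$, let $A_{\mathrm{rnr}}=[a_{ij}]_{i\in V_{\mathrm{nr}},\,j\in V_{\mathrm r}}$, let $B=\mathrm{diag}\{b_i\}_{i\in V_{\mathrm{nr}}}$ with $b_i=\sum_{j\in V_{\mathrm r}}|a_{ij}|$, and let $L_{ii}$ be $L$ with row and column $i$ deleted (a determinant or product over an empty index set is $1$). Consider the system $\dot{\boldsymbol x}(t)=-L\boldsymbol x(t)$, $t\ge 0$, with arbitrary initial state $\boldsymbol x(0)\in\mathbb R^V$. 1) If C1) or C2) holds, then there is a gauge transformation $D=\mathrm{diag}\{\sigma_i\}_{i\in V_{\mathrm r}}$, $\sigma_i\in\{-1,1\}$, with $\overline L_{\mathrm r}=DL_{\mathrm r}D$; moreover $\sum_{i\in V_{\mathrm r}}\det(L_{ii})\ne 0$ and $\det(L_{\mathrm{nr}}+B)\neq 0$. For every such $D$ let $\Phi_j$, $j\in V_{\mathrm{nr}}$, be the matrix obtained from $L_{\mathrm{nr}}+B$ by replacing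 its column $j$ with $-A_{\mathrm{rnr}}\xi_{\mathrm r}$, where $\xi_{\mathrm r}=(\sigma_i)_{i\in V_{\mathrm r}}$. Then $$\lim_{t\to\infty}x_i(t)=\frac{\sum_{k\in V_{\mathrm r}}\sigma_k\det(L_{kk})x_k(0)}{\sum_{k\in V_{\mathrm r}}\det(L_{kk})}\,\sigma_i\quad(i\in V_{\mathrm r}),$$ $$\lim_{t\to\infty}x_j(t)=-\frac{\sum_{k\in V_{\mathrm r}}\sigma_k\det(L_{kk})x_k(0)}{\sum_{k\in V_{\mathrm r}}\det(L_{kk})}\,\frac{\det(\Phi_j)}{\det(L_{\mathrm{nr}}+B)}\quad(j\in V_{\mathrm{nr}}).$$ 2) If C3) holds, then $\lim_{t\to\infty}x_i(t)=0$ for every $i\in V$ and every initial state (state stability). -/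

import Mathlib

open Filter Topology Matrix

/-- A weighted signed digraph without self-loops on the node set `V`, given by its adjacency
weight matrix: there is an edge from `j` to `i` exactly when `weight i j ≠ 0`. -/
structure SignedDigraph (V : Type*) where
  weight : Matrix V V ℝ
  loopless : ∀ i, weight i i = 0

namespace SignedDigraph

variable {V : Type*} (G : SignedDigraph V)

/-- There is an edge from `j` to `i`, that is, `j` is a neighbor of `i`. -/
def Edge (j i : V) : Prop := G.weight i j ≠ 0

/-- `k 0, k 1, …, k l` is a directed path of length `l ≥ 1` from `i` to `j`
(its nodes are distinct). -/
def IsPath (i j : V) (l : ℕ) (k : ℕ → V) : Prop :=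
  1 ≤ l ∧ k 0 = i ∧ k l = j ∧ (∀ s < l, G.Edge (k s) (k (s + 1))) ∧ Set.InjOn k (Set.Iic l)

/-- A rooted node: there is a directed path from it to every other node. -/
def IsRooted (i : V) : Prop := ∀ j, j ≠ i → ∃ l k, G.IsPath i j l k

/-- Quasi-strong connectivity: some node has directed paths to all other nodes. -/
def QuasiStronglyConnected : Prop := ∃ i, G.IsRooted i

/-- `k 0, k 1, …, k l = k 0` is a directed cycle of length `l ≥ 2`
(a closed path; `k 0, …, k (l - 1)` are distinct). -/
def IsCycle (l : ℕ) (k : ℕ → V) : Prop :=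
  2 ≤ l ∧ k l = k 0 ∧ (∀ s < l, G.Edge (k s) (k (s + 1))) ∧ Set.InjOn k (Set.Iio l)

/-- A rooted cycle: a directed cycle all of whose nodes are rooted. -/
def IsRootedCycle (l : ℕ) (k : ℕ → V) : Prop :=
  G.IsCycle l k ∧ ∀ s < l, G.IsRooted (k s)

/-- The product of the weights of the edges of a cycle; the cycle is positive or negative
according to the sign of this product. -/
def cycleWeight (l : ℕ) (k : ℕ → V) : ℝ := ∏ s ∈ Finset.range l, G.weight (k (s + 1)) (k s)

/-- There are no rooted cycles. -/
def CondC1 : Prop := ¬ ∃ l k, G.IsRootedCycle l k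

/-- All rooted cycles are positive. -/
def CondC2 : Prop := ∀ l k, G.IsRootedCycle l k → 0 < G.cycleWeight l k

/-- At least one rooted cycle is negative. -/
def CondC3 : Prop := ∃ l k, G.IsRootedCycle l k ∧ G.cycleWeight l k < 0

/-- The Laplacian matrix. (In a row, the non-neighbors contribute `0` to the diagonal entry.) -/
def laplacian [Fintype V] [DecidableEq V] : Matrix V V ℝ :=
  Matrix.of fun i j => if j = i then ∑ k, |G.weight i k| else -G.weight i j

/-- The subgraph induced on the nodes that satisfy `p`. -/
def induce (p : V → Prop) : SignedDigraph {v // p v} where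
  weight := G.weight.submatrix Subtype.val Subtype.val
  loopless i := G.loopless i

/-- The induced unsigned digraph, with weights `|a i j|`. -/
def unsigned : SignedDigraph V where
  weight := Matrix.of fun i j => |G.weight i j|
  loopless i := by simp [G.loopless i]

/-- The type of rooted nodes. -/
abbrev Rooted : Type _ := {v : V // G.IsRooted v}

/-- The type of non-rooted nodes. -/
abbrev NonRooted : Type _ := {v : V // ¬ G.IsRooted v}

/-- The subgraph on the rooted nodes. -/
def rootedPart : SignedDigraph G.Rooted := G.induce G.IsRooted

/-- The subgraph on the non-rooted nodes. -/
def nonRootedPart : SignedDigraph G.NonRooted := G.induce fun v => ¬ G.IsRooted v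

/-- The block `A_rnr` of the weight matrix: rows are non-rooted nodes, columns rooted nodes. -/
def weightRnr : Matrix G.NonRooted G.Rooted ℝ := G.weight.submatrix Subtype.val Subtype.val

variable [Fintype V] [DecidableEq V] [DecidablePred G.IsRooted]

/-- `L_nr + B`, where `L_nr` is the Laplacian matrix of the subgraph on the non-rooted nodes and
`B` is the diagonal matrix with entries `b i = ∑ j, |a i j|`, `j` running over the rooted nodes. -/
def laplacianNrAddB : Matrix G.NonRooted G.NonRooted ℝ :=
  G.nonRootedPart.laplacian + Matrix.diagonal fun i => ∑ j, |G.weightRnr i j|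

/-- `σ` is the diagonal of a gauge transformation `D` (entries `±1`) that takes the Laplacian
matrix `L_r` of the subgraph on the rooted nodes to that of the induced unsigned digraph of this
subgraph, by `D * L_r * D`. -/
def IsRootedGauge (σ : G.Rooted → ℝ) : Prop :=
  (∀ i, σ i = -1 ∨ σ i = 1) ∧
    G.rootedPart.unsigned.laplacian =
      Matrix.diagonal σ * G.rootedPart.laplacian * Matrix.diagonal σ

/-- `det (L_ii)`, where `L_ii` is the Laplacian matrix `L` without its row and column `i`. -/
def laplacianMinor {V : Type*} (G : SignedDigraph V) [Fintype V] [DecidableEq V] (i : V) : ℝ :=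
  (G.laplacian.submatrix (Subtype.val : {v // v ≠ i} → V) Subtype.val).det

/-- `Φ_j`: the matrix `L_nr + B` with its column `j` replaced by `-A_rnr ξ_r`, where
`ξ_r = D 1` is the vector with entries `σ i`. -/
def Phi (σ : G.Rooted → ℝ) (j : G.NonRooted) : Matrix G.NonRooted G.NonRooted ℝ :=
  G.laplacianNrAddB.updateCol j (-(G.weightRnr *ᵥ σ))

/-- The weighted average `(∑ i, σ i * det (L_ii) * x i) / ∑ i, det (L_ii)` of the entries of a
vector at the rooted nodes. -/
noncomputable def rootedAverage (σ : G.Rooted → ℝ) (x : V → ℝ) : ℝ :=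
  (∑ i : G.Rooted, σ i * G.laplacianMinor i * x i) / ∑ i : G.Rooted, G.laplacianMinor i

/-- `x` is a trajectory, for times `t ≥ 0`, of the system `x' = -L x`. -/
def IsTrajectory {V : Type*} (G : SignedDigraph V) [Fintype V] [DecidableEq V]
    (x : ℝ → V → ℝ) : Prop :=
  ∀ t, 0 ≤ t → HasDerivWithinAt x (-(G.laplacian *ᵥ x t)) (Set.Ici 0) t

/-- State stability: from every initial state, all states converge to zero. -/
def StateStable {V : Type*} (G : SignedDigraph V) [Fintype V] [DecidableEq V] : Prop :=
  ∀ x : ℝ → V → ℝ, G.IsTrajectory x → ∀ i, Tendsto (fun t => x t i) atTop (𝓝 0)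

end SignedDigraph

/-! Convergence needs no spectral theory. For large `c` the matrix `N = 1 - c⁻¹ L` is a sup-norm
contraction, and `exp (-t L) = exp (c t (N - 1))` is a Poisson average of powers of `N`. Hence `exp
(-t L) L` has norm `O(1/√t)` (`norm_one_sub_mul_exp_le`), and a trajectory starting at `u + L w`
with `L u = 0` tends to `u`. Applied to constant trajectories, this shows that kernel and range of
`L` meet only in `0`, so every initial state splits in this way.

It remains to find the kernel. By a maximum principle, maximal modulus spreads to in-neighbors,
hence back to every rooted node. A negative rooted cycle then forces the kernel to be `0`. If all
rooted cycles are positive, signs of walks from a root give a gauge, and the kernel is the line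
through `kernelVector`, equal to `σ` on rooted nodes and given by Cramer's rule elsewhere. A row of
the adjugate, a left kernel vector, reads off the coefficient along this line. -/

/-! ### Poisson averages of powers of a contraction -/

section PoissonBound

variable {𝔸 : Type*} [NormedRing 𝔸] [NormedAlgebra ℝ 𝔸] [CompleteSpace 𝔸]

open Nat in
theorem hasSum_natCast_mul_inv_factorial_smul_pow (x : 𝔸) :
    HasSum (fun n : ℕ => ((n : ℝ) * (n ! : ℝ)⁻¹) • x ^ n) (x * NormedSpace.exp x) := by
  rw [← hasSum_nat_add_iff' 1]
  have h := (NormedSpace.exp_series_hasSum_exp' (𝕂 := ℝ) x).mul_left x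
  simp only [Finset.range_one, Finset.sum_singleton, Nat.cast_zero, zero_mul, zero_smul, sub_zero]
  refine (congrArg (HasSum · _) (funext fun n => ?_)).mpr h
  rw [mul_smul_comm, _root_.pow_succ', Nat.factorial_succ]
  congr 1
  push_cast
  field_simp

open Nat in
-- For `t > 0` this is the variance of the Poisson law of mean `t`, before normalization by `exp
-- (-t)`.
theorem hasSum_sub_sq_mul_inv_factorial_mul_pow (t : ℝ) :
    HasSum (fun n : ℕ => (t - n) ^ 2 * ((n ! : ℝ)⁻¹ * t ^ n)) (t * Real.exp t) := by
  have h0 : HasSum (fun n : ℕ => (n ! : ℝ)⁻¹ * t ^ n) (Real.exp t) := by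
    simpa [Real.exp_eq_exp_ℝ] using NormedSpace.exp_series_hasSum_exp' (𝕂 := ℝ) t
  have h1 : HasSum (fun n : ℕ => ((n : ℝ) * (n ! : ℝ)⁻¹) * t ^ n) (t * Real.exp t) := by
    simpa [Real.exp_eq_exp_ℝ] using hasSum_natCast_mul_inv_factorial_smul_pow t
  have h2 : HasSum (fun n : ℕ => ((n : ℝ) ^ 2 * (n ! : ℝ)⁻¹) * t ^ n)
      (t * (t * Real.exp t + Real.exp t)) := by
    rw [← hasSum_nat_add_iff' 1]
    simp only [Finset.range_one, Finset.sum_singleton, Nat.cast_zero, ne_eq, OfNat.ofNat_ne_zero,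
      not_false_eq_true, zero_pow, zero_mul, sub_zero]
    refine (congrArg (HasSum · _) (funext fun n => ?_)).mpr ((h1.add h0).mul_left t)
    rw [Nat.factorial_succ]
    push_cast
    field_simp
    ring
  have h := ((h0.mul_left (t ^ 2)).sub (h1.mul_left (2 * t))).add h2
  rw [show t * Real.exp t = t ^ 2 * Real.exp t - 2 * t * (t * Real.exp t) +
    t * (t * Real.exp t + Real.exp t) by ring]
  exact (congrArg (HasSum · _) (funext fun n => by ring)).mpr h

open Nat in
/-- The exponential of `t (N - 1)` is a Poisson average of the powers of the contraction `N`, so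
that it is nearly invariant under multiplication by `N` for large `t`. -/
theorem norm_one_sub_mul_exp_le [NormOneClass 𝔸] {N : 𝔸} (hN : ‖N‖ ≤ 1) {t : ℝ} (ht : 0 < t) :
    ‖(1 - N) * NormedSpace.exp (t • (N - 1))‖ ≤ (√t)⁻¹ := by
  have hsum : HasSum (fun n : ℕ => ((t - n) * ((n ! : ℝ)⁻¹ * t ^ n)) • N ^ n)
      (t • ((1 - N) * NormedSpace.exp (t • N))) := by
    have h0 := (NormedSpace.exp_series_hasSum_exp' (𝕂 := ℝ) (t • N)).const_smul t
    have h1 := hasSum_natCast_mul_inv_factorial_smul_pow (t • N)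
    rw [sub_mul, one_mul, smul_sub, ← smul_mul_assoc]
    refine (congrArg (HasSum · _) (funext fun n => ?_)).mpr (h0.sub h1)
    rw [smul_pow, smul_smul, smul_smul, smul_smul, ← sub_smul]
    congr 1; ring
  have hs : 0 < √t := Real.sqrt_pos.2 ht
  have hst : √t * √t = t := Real.mul_self_sqrt ht.le
  have h0 : HasSum (fun n : ℕ => (n ! : ℝ)⁻¹ * t ^ n) (Real.exp t) := by
    simpa [Real.exp_eq_exp_ℝ] using NormedSpace.exp_series_hasSum_exp' (𝕂 := ℝ) t
  -- By AM-GM, `|t - n| ≤ √t / 2 + (t - n) ^ 2 / (2 √t)`; with variance `t`, both terms contribute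
  -- `√t / 2 * exp t`.
  have hbound : HasSum (fun n : ℕ => √t / 2 * ((n ! : ℝ)⁻¹ * t ^ n) +
      (2 * √t)⁻¹ * ((t - n) ^ 2 * ((n ! : ℝ)⁻¹ * t ^ n))) (√t * Real.exp t) := by
    have h := (h0.mul_left (√t / 2)).add
      ((hasSum_sub_sq_mul_inv_factorial_mul_pow t).mul_left (2 * √t)⁻¹)
    have e : √t / 2 * Real.exp t + (2 * √t)⁻¹ * (t * Real.exp t) = √t * Real.exp t := by
      rw [← hst]; simp only [Real.sqrt_mul_self hs.le]; field_simp; ring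
    rwa [e] at h
  have hle : ‖t • ((1 - N) * NormedSpace.exp (t • N))‖ ≤ √t * Real.exp t := by
    rw [← hsum.tsum_eq]
    refine tsum_of_norm_bounded hbound fun n => ?_
    have hp : 0 ≤ (n ! : ℝ)⁻¹ * t ^ n := by positivity
    have hNn : ‖N ^ n‖ ≤ 1 := (norm_pow_le N n).trans (pow_le_one₀ (norm_nonneg _) hN)
    have habs : |t - n| ≤ √t / 2 + (2 * √t)⁻¹ * (t - n) ^ 2 := by
      have h3 : √t / 2 + (2 * √t)⁻¹ * (t - n) ^ 2 - |t - n| =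
          (√t - |t - n|) ^ 2 / (2 * √t) := by
        rw [← sq_abs (t - n)]; field_simp; ring
      have : 0 ≤ (√t - |t - n|) ^ 2 / (2 * √t) := by positivity
      linarith
    calc ‖((t - n) * ((n ! : ℝ)⁻¹ * t ^ n)) • N ^ n‖
        = |t - n| * ((n ! : ℝ)⁻¹ * t ^ n) * ‖N ^ n‖ := by
          rw [norm_smul, Real.norm_eq_abs, abs_mul, abs_of_nonneg hp]
      _ ≤ |t - n| * ((n ! : ℝ)⁻¹ * t ^ n) * 1 := by gcongr
      _ ≤ (√t / 2 + (2 * √t)⁻¹ * (t - n) ^ 2) * ((n ! : ℝ)⁻¹ * t ^ n) * 1 := by gcongr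
      _ = _ := by ring
  have hexp : NormedSpace.exp (t • (N - 1)) = Real.exp (-t) • NormedSpace.exp (t • N) := by
    let _ : NormedAlgebra ℚ 𝔸 := NormedAlgebra.restrictScalars ℚ ℝ 𝔸
    have : t • (N - 1) = algebraMap ℝ 𝔸 (-t) + t • N := by
      rw [Algebra.algebraMap_eq_smul_one, smul_sub, neg_smul]; abel
    rw [this, NormedSpace.exp_add_of_commute (Algebra.commutes _ _),
      ← NormedSpace.algebraMap_exp_comm (𝕂 := ℝ) (𝔸 := 𝔸), ← Real.exp_eq_exp_ℝ,
      ← Algebra.smul_def]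
  rw [hexp, mul_smul_comm, norm_smul, Real.norm_eq_abs, Real.abs_exp, Real.exp_neg]
  rw [norm_smul, Real.norm_eq_abs, abs_of_pos ht] at hle
  have he := Real.exp_pos t
  rw [inv_mul_le_iff₀ he, ← div_eq_mul_inv, le_div_iff₀ hs]
  refine le_of_mul_le_mul_left ?_ hs
  calc √t * (‖(1 - N) * NormedSpace.exp (t • N)‖ * √t)
      = t * ‖(1 - N) * NormedSpace.exp (t • N)‖ := by
        rw [← hst]; simp only [Real.sqrt_mul_self hs.le]; ring
    _ ≤ _ := hle

end PoissonBound

/-! ### Solutions of linear equations with constant coefficients -/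

section LinearFlow

variable {E : Type*} [NormedAddCommGroup E] [NormedSpace ℝ E] [CompleteSpace E]

theorem exp_smul_apply_eq_of_hasDerivWithinAt_neg (A : E →L[ℝ] E) {x : ℝ → E}
    (hx : ∀ t, 0 ≤ t → HasDerivWithinAt x (-(A (x t))) (Set.Ici 0) t) {t : ℝ} (ht : 0 ≤ t) :
    NormedSpace.exp (t • A) (x t) = x 0 := by
  have hd : ∀ s, 0 ≤ s →
      HasDerivWithinAt (fun s => NormedSpace.exp (s • A) (x s)) 0 (Set.Ici 0) s := by
    intro s hs
    have h1 := (hasDerivAt_exp_smul_const (𝕂 := ℝ) A s).hasDerivWithinAt (s := Set.Ici 0)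
    have h2 := h1.clm_apply (hx s hs)
    convert h2 using 1
    simp
  have := constant_of_has_deriv_right_zero (f := fun s => NormedSpace.exp (s • A) (x s))
    (a := 0) (b := t) (fun s hs => ((hd s hs.1).continuousWithinAt).mono Set.Icc_subset_Ici_self)
    (fun s hs => (hd s hs.1).mono (Set.Ici_subset_Ici.2 hs.1)) t ⟨ht, le_rfl⟩
  simpa using this

theorem apply_eq_exp_of_hasDerivWithinAt_neg (A : E →L[ℝ] E) {x : ℝ → E}
    (hx : ∀ t, 0 ≤ t → HasDerivWithinAt x (-(A (x t))) (Set.Ici 0) t) {t : ℝ} (ht : 0 ≤ t) :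
    x t = NormedSpace.exp (-(t • A)) (x 0) := by
  rw [← exp_smul_apply_eq_of_hasDerivWithinAt_neg A hx ht, ← mul_apply_eq_comp]
  let _ : NormedAlgebra ℚ (E →L[ℝ] E) := NormedAlgebra.restrictScalars ℚ ℝ _
  have h : NormedSpace.exp (-(t • A) + t • A) =
      NormedSpace.exp (-(t • A)) * NormedSpace.exp (t • A) :=
    NormedSpace.exp_add_of_commute (Commute.refl _).neg_left
  rw [← h]
  simp

/-- If `1 - c⁻¹ A` is a contraction, a solution of `x' = -A x` that starts at the sum of a
point `u` of the kernel and of a point of the range of `A` converges to `u`. -/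
theorem tendsto_of_hasDerivWithinAt_neg [Nontrivial E] (A : E →L[ℝ] E) {c : ℝ} (hc : 0 < c)
    (hA : ‖1 - c⁻¹ • A‖ ≤ 1) {x : ℝ → E}
    (hx : ∀ t, 0 ≤ t → HasDerivWithinAt x (-(A (x t))) (Set.Ici 0) t) {u w : E} (hu : A u = 0)
    (h0 : x 0 = u + A w) : Tendsto x atTop (𝓝 u) := by
  have hy : ∀ t, 0 ≤ t →
      HasDerivWithinAt (fun t => x t - u) (-(A (x t - u))) (Set.Ici 0) t := by
    intro t ht
    simpa [hu] using (hx t ht).sub_const u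
  rw [← tendsto_sub_nhds_zero_iff]
  -- With `N = 1 - c⁻¹ A`, `x t - u = exp (-t A) (A w)` equals `c (1 - N) exp (c t (N - 1)) w`.
  refine squeeze_zero_norm' (a := fun t => c * (√(c * t))⁻¹ * ‖w‖) ?_ ?_
  · filter_upwards [eventually_gt_atTop 0] with t ht
    have h1 := apply_eq_exp_of_hasDerivWithinAt_neg A hy ht.le
    simp only [h0, add_sub_cancel_left] at h1
    rw [h1, ← mul_apply_eq_comp]
    have hcomm : NormedSpace.exp (-(t • A)) * A = A * NormedSpace.exp (-(t • A)) := by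
      have : Commute A (-(t • A)) := ((Commute.refl A).smul_right t).neg_right
      exact (this.exp_right).eq.symm
    have hN := norm_one_sub_mul_exp_le hA (mul_pos hc ht)
    have e1 : (c * t) • (1 - c⁻¹ • A - 1) = -(t • A) := by
      rw [sub_sub_cancel_left, smul_neg, smul_smul]
      congr 2; field_simp
    have e2 : A = c • (1 - (1 - c⁻¹ • A)) := by
      rw [sub_sub_cancel, smul_smul, mul_inv_cancel₀ hc.ne', one_smul]
    rw [e1] at hN
    rw [hcomm]
    refine (ContinuousLinearMap.le_opNorm _ _).trans ?_
    gcongr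
    conv_lhs => rw [show A * NormedSpace.exp (-(t • A)) =
      c • ((1 - (1 - c⁻¹ • A)) * NormedSpace.exp (-(t • A))) by
        rw [← smul_mul_assoc, ← e2]]
    rw [norm_smul, Real.norm_eq_abs, abs_of_pos hc]
    gcongr
  · have : Tendsto (fun t : ℝ => (√(c * t))⁻¹) atTop (𝓝 0) :=
      (Real.tendsto_sqrt_atTop.comp (tendsto_id.const_mul_atTop hc)).inv_tendsto_atTop
    simpa using (this.const_mul c).mul_const ‖w‖

end LinearFlow

/-! ### Walks, rooted nodes and signs -/

namespace SignedDigraph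

section Walks

variable {V : Type*} (G : SignedDigraph V)

/-- `k 0, …, k l` is a directed walk from `i` to `j` (its nodes need not be distinct). -/
def IsWalk (i j : V) (l : ℕ) (k : ℕ → V) : Prop :=
  k 0 = i ∧ k l = j ∧ ∀ s < l, G.Edge (k s) (k (s + 1))

variable {G}

/-- A walk that visits a node twice splits into a shorter walk and a closed walk. -/
theorem IsWalk.exists_splice {i j : V} {l : ℕ} {k : ℕ → V} (h : G.IsWalk i j l k) {p q : ℕ}
    (hpq : p < q) (hq : q ≤ l) (hk : k p = k q) :
    ∃ k', G.IsWalk i j (l - (q - p)) k' ∧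
      G.IsWalk (k p) (k p) (q - p) (fun s => k (p + s)) ∧
      G.cycleWeight l k = G.cycleWeight (l - (q - p)) k' *
        G.cycleWeight (q - p) (fun s => k (p + s)) ∧
      ∀ s < l - (q - p), ∃ s' < l, k' s = k s' := by
  obtain ⟨d, rfl⟩ := Nat.exists_eq_add_of_lt hpq
  obtain ⟨e, rfl⟩ := Nat.exists_eq_add_of_le hq
  obtain ⟨h0, hl, hE⟩ := h
  have e1 : p + d + 1 + e - (p + d + 1 - p) = p + e := by omega
  have e2 : p + d + 1 - p = d + 1 := by omega
  rw [e1, e2]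
  -- The stretch from `p` to `q = p + d + 1` is cut out; since `k p = k q`, both branches agree at
  -- `s = p`.
  set k' : ℕ → V := fun s => if s ≤ p then k s else k (s + (d + 1)) with hk'
  have hk1 : ∀ s ≤ p, k' s = k s := fun s hs => by simp [hk', hs]
  have hk2 : ∀ s, k' (p + s) = k (p + d + 1 + s) := by
    intro s
    rcases Nat.eq_zero_or_pos s with rfl | hs
    · simp [hk', hk]
    · have : ¬ p + s ≤ p := by omega
      simp only [hk', this, if_false]; congr 1; omega
  refine ⟨k', ⟨?_, ?_, ?_⟩, ⟨rfl, ?_, ?_⟩, ?_, ?_⟩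
  · rw [hk1 0 (Nat.zero_le _), h0]
  · rw [hk2, hl]
  · intro s hs
    rcases lt_or_ge s p with hsp | hsp
    · rw [hk1 s hsp.le, hk1 (s + 1) hsp]; exact hE s (by omega)
    · obtain ⟨m, rfl⟩ := Nat.exists_eq_add_of_le hsp
      rw [add_assoc, hk2, hk2]; exact hE (p + d + 1 + m) (by omega)
  · exact hk.symm
  · intro s hs; exact hE (p + s) (by omega)
  · unfold cycleWeight
    rw [show p + d + 1 + e = p + (d + 1) + e by ring, Finset.prod_range_add _ (p + (d + 1)) e,
      Finset.prod_range_add _ p (d + 1), Finset.prod_range_add _ p e]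
    have a1 : ∏ s ∈ Finset.range p, G.weight (k' (s + 1)) (k' s) =
        ∏ s ∈ Finset.range p, G.weight (k (s + 1)) (k s) := by
      refine Finset.prod_congr rfl fun s hs => ?_
      have := Finset.mem_range.1 hs
      rw [hk1 s this.le, hk1 (s + 1) this]
    have a2 : ∏ s ∈ Finset.range e, G.weight (k' (p + s + 1)) (k' (p + s)) =
        ∏ s ∈ Finset.range e, G.weight (k (p + (d + 1) + s + 1)) (k (p + (d + 1) + s)) := by
      refine Finset.prod_congr rfl fun s _ => ?_
      rw [add_assoc p s 1, hk2, hk2]; rfl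
    rw [a1, a2]
    simp only [add_assoc]
    ring
  · intro s hs
    rcases le_or_gt s p with hsp | hsp
    · exact ⟨s, by omega, hk1 s hsp⟩
    · obtain ⟨m, rfl⟩ := Nat.exists_eq_add_of_le hsp.le
      exact ⟨p + d + 1 + m, by omega, hk2 m⟩

theorem exists_lt_of_not_injOn {k : ℕ → V} {S : Set ℕ} (h : ¬ Set.InjOn k S) :
    ∃ p q, p ∈ S ∧ q ∈ S ∧ p < q ∧ k p = k q := by
  simp only [Set.InjOn, not_forall] at h
  obtain ⟨p, hp, q, hq, hpq, hne⟩ := h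
  rcases lt_or_gt_of_ne hne with h | h
  · exact ⟨p, q, hp, hq, h, hpq⟩
  · exact ⟨q, p, hq, hp, h, hpq.symm⟩

theorem IsWalk.exists_isPath {i j : V} (hij : j ≠ i) {l : ℕ} :
    ∀ {k : ℕ → V}, G.IsWalk i j l k → ∃ l k, G.IsPath i j l k := by
  induction l using Nat.strong_induction_on with
  | _ l ih =>
    intro k h
    by_cases hinj : Set.InjOn k (Set.Iic l)
    · refine ⟨l, k, ?_, h.1, h.2.1, h.2.2, hinj⟩
      rcases Nat.eq_zero_or_pos l with rfl | hl
      · exact absurd (h.2.1.symm.trans h.1) hij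
      · exact hl
    · obtain ⟨p, q, -, hq, hpq, hk⟩ := exists_lt_of_not_injOn hinj
      obtain ⟨k', h', -⟩ := h.exists_splice hpq hq hk
      have hq' : q ≤ l := hq
      exact ih _ (by omega) h'

/-- If all rooted cycles are positive, then so are all closed walks through rooted nodes. -/
theorem CondC2.cycleWeight_pos (hC : G.CondC2) {l : ℕ} :
    ∀ {i : V} {k : ℕ → V}, G.IsWalk i i l k → (∀ s < l, G.IsRooted (k s)) →
      0 < G.cycleWeight l k := by
  induction l using Nat.strong_induction_on with
  | _ l ih =>
    intro i k h hr
    by_cases hinj : Set.InjOn k (Set.Iio l)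
    · rcases Nat.lt_or_ge l 2 with hl | hl
      -- Length `0` gives the empty product `1`; length `1` would be a loop.
      · interval_cases l
        · simp [cycleWeight]
        · have h1 := h.2.2 0 one_pos
          have : k 1 = k 0 := h.2.1.trans h.1.symm
          rw [Edge, zero_add, this] at h1
          exact absurd (G.loopless _) h1
      · exact hC l k ⟨⟨hl, h.2.1.trans h.1.symm, h.2.2, hinj⟩, hr⟩
    · obtain ⟨p, q, -, hq, hpq, hk⟩ := exists_lt_of_not_injOn hinj
      have hq' : q < l := hq
      obtain ⟨k', h', h'', hw, hs⟩ := h.exists_splice hpq hq'.le hk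
      rw [hw]
      refine mul_pos (ih _ (by omega) h' fun s hsl => ?_) (ih _ (by omega) h'' fun s hsl => ?_)
      · obtain ⟨s', hs', e⟩ := hs s hsl
        rw [e]; exact hr s' hs'
      · exact hr _ (by omega)

variable (G) in
/-- There is a walk from `i` to `j` with product of the edge weights `w`. -/
inductive WalkWeight (i : V) : V → ℝ → Prop
  | refl : WalkWeight i i 1
  | tail {j m : V} {w : ℝ} : WalkWeight i j w → G.Edge j m → WalkWeight i m (w * G.weight m j)

theorem WalkWeight.trans {i j m : V} {w w' : ℝ} (h : G.WalkWeight i j w)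
    (h' : G.WalkWeight j m w') : G.WalkWeight i m (w * w') := by
  induction h' with
  | refl => simpa using h
  | tail _ he ih => rw [← mul_assoc]; exact ih.tail he

theorem WalkWeight.ne_zero {i j : V} {w : ℝ} (h : G.WalkWeight i j w) : w ≠ 0 := by
  induction h with
  | refl => exact one_ne_zero
  | tail _ he ih => exact mul_ne_zero ih he

theorem WalkWeight.of_forall_edge {M : V → Prop} (hM : ∀ i j, M i → G.Edge j i → M j) {i j : V}
    {w : ℝ} (h : G.WalkWeight j i w) (hi : M i) : M j := by
  induction h with
  | refl => exact hi
  | tail _ he ih => exact ih (hM _ _ hi he)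

theorem IsWalk.snoc {i j m : V} {l : ℕ} {k : ℕ → V} (h : G.IsWalk i j l k) (he : G.Edge j m) :
    ∃ k', G.IsWalk i m (l + 1) k' ∧ G.cycleWeight (l + 1) k' = G.cycleWeight l k * G.weight m j := by
  obtain ⟨h0, hl, hE⟩ := h
  have hk : ∀ s ≤ l, Function.update k (l + 1) m s = k s := fun s hs =>
    Function.update_of_ne (by omega) _ _
  refine ⟨Function.update k (l + 1) m, ⟨?_, ?_, ?_⟩, ?_⟩
  · rw [hk 0 (Nat.zero_le _), h0]
  · simp
  · intro s hs
    rcases Nat.lt_succ_iff_lt_or_eq.1 hs with h | rfl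
    · rw [hk s h.le, hk (s + 1) h]; exact hE s h
    · rw [hk s le_rfl, hl]; simpa using he
  · unfold cycleWeight
    rw [Finset.prod_range_succ]
    congr 1
    · refine Finset.prod_congr rfl fun s hs => ?_
      have := Finset.mem_range.1 hs
      rw [hk s this.le, hk (s + 1) this]
    · rw [hk l le_rfl, hl]; simp

theorem WalkWeight.exists_isWalk {i j : V} {w : ℝ} (h : G.WalkWeight i j w) :
    ∃ l k, G.IsWalk i j l k ∧ G.cycleWeight l k = w := by
  induction h with
  | refl => exact ⟨0, fun _ => i, ⟨rfl, rfl, by simp⟩, by simp [cycleWeight]⟩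
  | tail _ he ih =>
    obtain ⟨l, k, hk, rfl⟩ := ih
    obtain ⟨k', h1, h2⟩ := hk.snoc he
    exact ⟨l + 1, k', h1, h2⟩

theorem IsWalk.walkWeight {i j : V} {l : ℕ} {k : ℕ → V} (h : G.IsWalk i j l k) {p q : ℕ}
    (hpq : p ≤ q) (hq : q ≤ l) : ∃ w, G.WalkWeight (k p) (k q) w := by
  induction q, hpq using Nat.le_induction with
  | base => exact ⟨1, .refl⟩
  | succ q _ ih =>
    obtain ⟨w, hw⟩ := ih (by omega)
    exact ⟨_, hw.tail (h.2.2 q (by omega))⟩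

theorem IsRooted.exists_walkWeight {i : V} (h : G.IsRooted i) (j : V) :
    ∃ w, G.WalkWeight i j w := by
  rcases eq_or_ne j i with rfl | hj
  · exact ⟨1, .refl⟩
  · obtain ⟨l, k, _, h0, hl, hE, _⟩ := h j hj
    have := (show G.IsWalk i j l k from ⟨h0, hl, hE⟩).walkWeight (Nat.zero_le l) le_rfl
    rwa [h0, hl] at this

/-- No edge can thus enter the rooted part from outside, which makes the Laplacian block triangular.
-/
theorem IsRooted.of_walkWeight {i j : V} {w : ℝ} (hi : G.IsRooted i) (h : G.WalkWeight j i w) :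
    G.IsRooted j := by
  intro m hm
  obtain ⟨w', h'⟩ := hi.exists_walkWeight m
  obtain ⟨l, k, hk, -⟩ := (h.trans h').exists_isWalk
  exact hk.exists_isPath hm

theorem IsRooted.of_edge {i j : V} (hi : G.IsRooted i) (h : G.Edge j i) : G.IsRooted j :=
  hi.of_walkWeight (WalkWeight.refl.tail h)

theorem weight_eq_zero_of_isRooted {i j : V} (hi : G.IsRooted i) (hj : ¬ G.IsRooted j) :
    G.weight i j = 0 :=
  not_not.1 fun h => hj (hi.of_edge h)

theorem CondC2.walkWeight_pos (hC : G.CondC2) {i : V} (hi : G.IsRooted i) {w : ℝ}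
    (h : G.WalkWeight i i w) : 0 < w := by
  obtain ⟨l, k, hk, rfl⟩ := h.exists_isWalk
  refine hC.cycleWeight_pos hk fun s hs => ?_
  obtain ⟨w', hw⟩ := hk.walkWeight hs.le le_rfl
  rw [hk.2.1] at hw
  exact hi.of_walkWeight hw

/-- The sign of `i` is that of a chosen walk from a fixed root `r` to `i`. For an edge from `j` to
`i`, a common walk back to `r` closes both the walk to `i` and the walk to `j` extended by the edge;
both closed walks are positive. -/
theorem exists_sign_of_condC2 (hG : G.QuasiStronglyConnected) (hC : G.CondC2) :
    ∃ σ : V → ℝ, (∀ i, σ i = -1 ∨ σ i = 1) ∧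
      ∀ i j, G.IsRooted i → G.weight i j = σ i * σ j * |G.weight i j| := by
  obtain ⟨r, hr⟩ := hG
  choose w hw using hr.exists_walkWeight
  refine ⟨fun i => SignType.sign (w i), fun i => ?_, fun i j hi => ?_⟩
  · rcases lt_or_gt_of_ne (hw i).ne_zero with h | h
    · left; simp [h]
    · right; simp [h]
  · by_cases he : G.weight i j = 0
    · simp [he]
    obtain ⟨b, hb⟩ := hi.exists_walkWeight r
    have p1 : 0 < w i * b := hC.walkWeight_pos hr ((hw i).trans hb)
    have p2 : 0 < w j * G.weight i j * b := hC.walkWeight_pos hr (((hw j).tail he).trans hb)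
    have p3 : 0 < w i * w j * G.weight i j := by
      have := mul_pos p1 p2
      have hb2 : 0 < b ^ 2 := by have := hb.ne_zero; positivity
      nlinarith [this, hb2]
    have := sign_pos p3
    rw [sign_mul, sign_mul] at this
    have h1 : (SignType.sign (w i) : ℝ) * SignType.sign (w j) *
        SignType.sign (G.weight i j) = 1 := by
      exact_mod_cast congrArg (SignType.cast : SignType → ℝ) this
    rw [← sign_mul_self (G.weight i j), ← mul_assoc, h1, one_mul]

end Walks

end SignedDigraph

/-- Replacing row `k` by the unit vector leaves a block triangular matrix. -/
theorem Matrix.adjugate_self_eq_det_submatrix {n R : Type*} [Fintype n] [DecidableEq n]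
    [CommRing R] (M : Matrix n n R) (k : n) :
    M.adjugate k k = (M.submatrix (Subtype.val : {i // i ≠ k} → n) Subtype.val).det := by
  rw [adjugate_apply, twoBlockTriangular_det _ (fun i => i ≠ k)]
  · have h1 : (toSquareBlockProp (M.updateRow k (Pi.single k 1)) fun i => i ≠ k) =
        M.submatrix Subtype.val Subtype.val := by
      ext i j
      simp [toSquareBlockProp_def, updateRow_ne i.2]
    have h2 : (toSquareBlockProp (M.updateRow k (Pi.single k 1)) fun i => ¬ i ≠ k) = 1 := by
      ext i j
      obtain ⟨i, hi⟩ := i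
      obtain ⟨j, hj⟩ := j
      obtain rfl := not_not.1 hi
      obtain rfl := not_not.1 hj
      simp [toSquareBlockProp_def]
    rw [h1, h2, det_one, mul_one]
  · intro i hi j hj
    obtain rfl := not_not.1 hi
    simp [hj]

/-! ### Maximum principle and decomposition for the Laplacian -/

namespace SignedDigraph

section Laplacian

variable {V : Type*} [Fintype V] [DecidableEq V] {G : SignedDigraph V}

theorem laplacian_mulVec_apply (x : V → ℝ) (i : V) :
    (G.laplacian *ᵥ x) i = ∑ k, (|G.weight i k| * x i - G.weight i k * x k) := by
  rw [Finset.sum_sub_distrib, ← Finset.sum_mul]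
  have : ∀ j, G.laplacian i j * x j =
      (if j = i then (∑ k, |G.weight i k|) * x i else 0) - G.weight i j * x j := by
    intro j
    simp only [laplacian, of_apply]
    split_ifs with h
    · subst h; simp [G.loopless]
    · ring
  simp [mulVec, dotProduct, this]

/-- The maximum principle: at a node of largest modulus at which `L x` vanishes, the
in-neighbors have the same modulus and the signs prescribed by the weights. -/
theorem weight_mul_eq_of_forall_abs_le {x : V → ℝ} {i : V} (hi : ∀ j, |x j| ≤ |x i|)
    (h0 : (G.laplacian *ᵥ x) i = 0) (j : V) : G.weight i j * x j = |G.weight i j| * x i := by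
  by_cases hx : x i = 0
  · have : x j = 0 := by simpa [hx] using hi j
    simp [this, hx]
  rw [laplacian_mulVec_apply] at h0
  have h1 : ∑ k, (|G.weight i k| * x i - G.weight i k * x k) * x i = 0 := by
    rw [← Finset.sum_mul, h0, zero_mul]
  -- Multiplied by `x i`, every summand of `(L x) i` is nonnegative, so each one vanishes.
  have h2 : ∀ k ∈ Finset.univ, 0 ≤ (|G.weight i k| * x i - G.weight i k * x k) * x i := by
    intro k _
    have h3 : G.weight i k * x k * x i ≤ |G.weight i k| * |x i| * |x i| := by
      refine (le_abs_self _).trans ?_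
      rw [abs_mul, abs_mul]
      exact mul_le_mul_of_nonneg_right
        (mul_le_mul_of_nonneg_left (hi k) (abs_nonneg _)) (abs_nonneg _)
    have h4 : |x i| * |x i| = x i * x i := abs_mul_abs_self _
    have h5 : |G.weight i k| * |x i| * |x i| = |G.weight i k| * x i * x i := by
      rw [mul_assoc, h4, mul_assoc]
    rw [sub_mul]
    linarith
  have h5 := (Finset.sum_eq_zero_iff_of_nonneg h2).1 h1 j (Finset.mem_univ _)
  have := (mul_eq_zero.1 h5).resolve_right hx
  linarith

theorem abs_eq_of_edge_of_forall_abs_le {x : V → ℝ} {i j : V} (hi : ∀ j, |x j| ≤ |x i|)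
    (h0 : (G.laplacian *ᵥ x) i = 0) (he : G.Edge j i) : |x j| = |x i| := by
  have h := congrArg abs (weight_mul_eq_of_forall_abs_le hi h0 j)
  rw [abs_mul, abs_mul, abs_abs] at h
  exact mul_left_cancel₀ (abs_ne_zero.2 he) h

/-- A nonzero maximal modulus occurs only outside `P`, so it spreads backwards along a walk from
`r`, up to `r` itself, where `z` vanishes. -/
theorem eq_zero_of_laplacian_mulVec_eq_zero {P : V → Prop} {r : V} (hr : G.IsRooted r) (hPr : P r)
    {z : V → ℝ} (hz : ∀ i, P i → z i = 0) (hL : ∀ i, ¬ P i → (G.laplacian *ᵥ z) i = 0) :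
    z = 0 := by
  obtain ⟨i, -, hi⟩ := Finset.exists_max_image Finset.univ (fun i => |z i|) ⟨r, Finset.mem_univ _⟩
  have hi' : ∀ j, |z j| ≤ |z i| := fun j => hi j (Finset.mem_univ _)
  suffices h : |z i| = 0 by
    ext j
    simpa using (hi' j).trans h.le
  by_contra hne
  obtain ⟨w, hw⟩ := hr.exists_walkWeight i
  have := hw.of_forall_edge (M := fun j => |z j| = |z i|) (fun j k hj he => by
    have hPj : ¬ P j := fun hP => hne (by rw [← hj, hz j hP, abs_zero])
    exact (abs_eq_of_edge_of_forall_abs_le (fun m => hj ▸ hi' m) (hL j hPj) he).trans hj) rfl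
  exact hne (by rw [← this, hz r hPr, abs_zero])

/-- If `z ≠ 0`, all rooted nodes have maximal modulus. Multiplying the equalities of the maximum
principle around the cycle cancels the entries of `z` and makes the cycle weight a product of
absolute values. -/
theorem CondC3.eq_zero_of_laplacian_mulVec_eq_zero (hC : G.CondC3) {z : V → ℝ}
    (hL : G.laplacian *ᵥ z = 0) : z = 0 := by
  obtain ⟨l, k, ⟨⟨hl, hk, -, -⟩, hr⟩, hneg⟩ := hC
  obtain ⟨i, -, hi⟩ := Finset.exists_max_image Finset.univ (fun i => |z i|)
    ⟨k 0, Finset.mem_univ _⟩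
  have hi' : ∀ j, |z j| ≤ |z i| := fun j => hi j (Finset.mem_univ _)
  suffices h : |z i| = 0 by
    ext j
    simpa using (hi' j).trans h.le
  by_contra hne
  have hroot : ∀ r, G.IsRooted r → |z r| = |z i| := by
    intro r hr
    obtain ⟨w, hw⟩ := hr.exists_walkWeight i
    exact hw.of_forall_edge (M := fun j => |z j| = |z i|) (fun j k hj he =>
      (abs_eq_of_edge_of_forall_abs_le (fun m => hj ▸ hi' m) (congrFun hL j) he).trans hj) rfl
  have hrl : ∀ s ≤ l, G.IsRooted (k s) := fun s hs => by
    rcases hs.lt_or_eq with h | rfl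
    · exact hr s h
    · rw [hk]; exact hr 0 (by omega)
  have h1 : G.cycleWeight l k * ∏ s ∈ Finset.range l, z (k s) =
      (∏ s ∈ Finset.range l, |G.weight (k (s + 1)) (k s)|) * ∏ s ∈ Finset.range l, z (k (s + 1)) := by
    rw [cycleWeight, ← Finset.prod_mul_distrib, ← Finset.prod_mul_distrib]
    refine Finset.prod_congr rfl fun s hs => ?_
    have := Finset.mem_range.1 hs
    exact weight_mul_eq_of_forall_abs_le (fun m => (hroot _ (hrl (s + 1) this)).symm ▸ hi' m)
      (congrFun hL _) _
  have hzk : ∀ s ≤ l, z (k s) ≠ 0 := fun s hs h => hne (by rw [← hroot _ (hrl s hs), h, abs_zero])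
  have h2 : ∏ s ∈ Finset.range l, z (k (s + 1)) = ∏ s ∈ Finset.range l, z (k s) := by
    have a := Finset.prod_range_succ (fun s => z (k s)) l
    rw [Finset.prod_range_succ', hk] at a
    exact mul_right_cancel₀ (hzk 0 (Nat.zero_le _)) a
  have h3 : ∏ s ∈ Finset.range l, z (k s) ≠ 0 :=
    Finset.prod_ne_zero_iff.2 fun s hs => hzk s (Finset.mem_range.1 hs).le
  rw [h2] at h1
  have h4 := mul_right_cancel₀ h3 h1
  rw [h4] at hneg
  exact hneg.not_ge (Finset.prod_nonneg fun _ _ => abs_nonneg _)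

/-- A kernel vector of the submatrix, extended by zero, falls under the previous uniqueness
statement. This covers both the minors at rooted nodes and `L_nr + B`. -/
theorem det_laplacian_submatrix_ne_zero {q : V → Prop} [DecidablePred q] {r : V}
    (hr : G.IsRooted r) (hq : ¬ q r) :
    (G.laplacian.submatrix (Subtype.val : {i // q i} → V) Subtype.val).det ≠ 0 := by
  intro h
  obtain ⟨y, hy, hMy⟩ := exists_mulVec_eq_zero_iff.2 h
  set z : V → ℝ := fun i => if h : q i then y ⟨i, h⟩ else 0 with hz
  have hz1 : ∀ i : {i // q i}, z i = y i := fun i => by simp [hz, i.2]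
  have hz2 : ∀ i, ¬ q i → z i = 0 := fun i hi => by simp [hz, hi]
  have hz0 : z = 0 := by
    refine eq_zero_of_laplacian_mulVec_eq_zero (P := fun i => ¬ q i) hr hq hz2 fun i hi => ?_
    have e := congrFun hMy ⟨i, not_not.1 hi⟩
    rw [mulVec, dotProduct, ← Fintype.sum_subtype_add_sum_subtype q]
    rw [Finset.sum_eq_zero (s := (Finset.univ : Finset {i // ¬ q i}))
      fun j _ => by rw [hz2 j j.2, mul_zero], add_zero]
    simp only [hz1]
    simpa [mulVec, dotProduct] using e
  exact hy (funext fun i => by rw [← hz1, hz0]; rfl)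

theorem laplacianMinor_ne_zero {r : V} (hr : G.IsRooted r) : G.laplacianMinor r ≠ 0 :=
  det_laplacian_submatrix_ne_zero hr (not_not.2 rfl)

theorem IsTrajectory.tendsto [Nonempty V] {x : ℝ → V → ℝ} (hx : G.IsTrajectory x) {u w : V → ℝ}
    (hu : G.laplacian *ᵥ u = 0) (h0 : x 0 = u + G.laplacian *ᵥ w) : Tendsto x atTop (𝓝 u) := by
  -- `c` is positive even without edges and bounds every row sum, so the rows of `1 - c⁻¹ L` have
  -- absolute sum `1`.
  set c : ℝ := 1 + ∑ i, ∑ k, |G.weight i k| with hc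
  have hc0 : 0 < c := by positivity
  have hd : ∀ i, ∑ k, |G.weight i k| ≤ c := fun i => by
    have := Finset.single_le_sum (f := fun i => ∑ k, |G.weight i k|)
      (fun i _ => by positivity) (Finset.mem_univ i)
    exact this.trans (by rw [hc]; linarith)
  refine tendsto_of_hasDerivWithinAt_neg (LinearMap.toContinuousLinearMap G.laplacian.mulVecLin)
    hc0 ?_ (w := w) hx (by simpa using hu) (by simpa using h0)
  refine ContinuousLinearMap.opNorm_le_bound _ zero_le_one fun y => ?_
  rw [one_mul, pi_norm_le_iff_of_nonneg (norm_nonneg _)]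
  intro i
  have hyk : ∀ k, |y k| ≤ ‖y‖ := fun k => norm_le_pi_norm y k
  have e : (1 - c⁻¹ • LinearMap.toContinuousLinearMap G.laplacian.mulVecLin : (V → ℝ) →L[ℝ] V → ℝ)
      y i
      = (1 - c⁻¹ * ∑ k, |G.weight i k|) * y i + c⁻¹ * ∑ k, G.weight i k * y k := by
    simp [laplacian_mulVec_apply, Finset.sum_sub_distrib, ← Finset.sum_mul]
    ring
  have h1 : 0 ≤ 1 - c⁻¹ * ∑ k, |G.weight i k| := by
    rw [sub_nonneg, inv_mul_le_iff₀ hc0, mul_one]; exact hd i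
  have h2 : |∑ k, G.weight i k * y k| ≤ (∑ k, |G.weight i k|) * ‖y‖ := by
    rw [Finset.sum_mul]
    refine (Finset.abs_sum_le_sum_abs _ _).trans (Finset.sum_le_sum fun k _ => ?_)
    rw [abs_mul]
    gcongr
    exact hyk k
  rw [e, Real.norm_eq_abs]
  calc _ ≤ |(1 - c⁻¹ * ∑ k, |G.weight i k|) * y i| + |c⁻¹ * ∑ k, G.weight i k * y k| :=
        abs_add_le _ _
    _ = (1 - c⁻¹ * ∑ k, |G.weight i k|) * |y i| + c⁻¹ * |∑ k, G.weight i k * y k| := by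
        rw [abs_mul, abs_mul, abs_of_nonneg h1, abs_of_pos (inv_pos.2 hc0)]
    _ ≤ (1 - c⁻¹ * ∑ k, |G.weight i k|) * ‖y‖ + c⁻¹ * ((∑ k, |G.weight i k|) * ‖y‖) := by
        gcongr
        exact hyk i
    _ = ‖y‖ := by ring

/-- A vector `L w` in the kernel is a constant trajectory, yet it tends to `0`. -/
theorem disjoint_ker_range_laplacian [Nonempty V] :
    Disjoint (LinearMap.ker G.laplacian.mulVecLin) (LinearMap.range G.laplacian.mulVecLin) := by
  rw [Submodule.disjoint_def]
  rintro u hu ⟨w, rfl⟩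
  have hu' : G.laplacian *ᵥ (G.laplacian *ᵥ w) = 0 := by simpa using hu
  have htraj : G.IsTrajectory fun _ => G.laplacian *ᵥ w := fun t _ => by
    simpa [hu'] using hasDerivWithinAt_const t (Set.Ici 0) (G.laplacian *ᵥ w)
  have := htraj.tendsto (u := 0) (w := w) (by simp) (by simp)
  simpa using tendsto_nhds_unique tendsto_const_nhds this

theorem exists_eq_add_laplacian_mulVec [Nonempty V] (x : V → ℝ) :
    ∃ u w, G.laplacian *ᵥ u = 0 ∧ x = u + G.laplacian *ᵥ w := by
  have h := Submodule.eq_top_of_disjoint _ _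
    (by rw [add_comm, LinearMap.finrank_range_add_finrank_ker])
    (disjoint_ker_range_laplacian (G := G))
  obtain ⟨u, hu, y, ⟨w, rfl⟩, rfl⟩ := Submodule.mem_sup.1 (h ▸ Submodule.mem_top : x ∈ _)
  exact ⟨u, w, by simpa using hu, by simp⟩

theorem stateStable_of_condC3 (hC : G.CondC3) : G.StateStable := by
  intro x hx i
  have : Nonempty V := ⟨i⟩
  obtain ⟨u, w, hu, h0⟩ := G.exists_eq_add_laplacian_mulVec (x 0)
  obtain rfl := hC.eq_zero_of_laplacian_mulVec_eq_zero hu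
  exact (tendsto_pi_nhds.1 (hx.tendsto hu h0)) i

end Laplacian

/-! ### Gauge, kernel vectors and the limit -/

section Gauge

variable {V : Type*} [Fintype V] [DecidableEq V] {G : SignedDigraph V} [DecidablePred G.IsRooted]

theorem isRootedGauge_iff {σ : G.Rooted → ℝ} :
    G.IsRootedGauge σ ↔ (∀ i, σ i = -1 ∨ σ i = 1) ∧
      ∀ i j : G.Rooted, |G.weight i j| = σ i * G.weight i j * σ j := by
  refine and_congr_right fun hσ => ?_
  have hs : ∀ i, σ i * σ i = 1 := fun i => by rcases hσ i with h | h <;> simp [h]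
  constructor
  · intro h i j
    rcases eq_or_ne j i with rfl | hij
    · simp [G.loopless]
    · have := congrFun (congrFun h i) j
      simp [laplacian, unsigned, rootedPart, induce, mul_diagonal, diagonal_mul, hij] at this
      linarith
  · intro h
    ext i j
    rw [mul_diagonal, diagonal_mul]
    rcases eq_or_ne j i with rfl | hij
    · simp only [laplacian, unsigned, of_apply, if_true, abs_abs]
      rw [mul_right_comm, hs, one_mul]
    · simp [laplacian, unsigned, rootedPart, induce, hij, h i j]

theorem CondC2.exists_isRootedGauge (hC : G.CondC2) (hG : G.QuasiStronglyConnected) :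
    ∃ σ : G.Rooted → ℝ, G.IsRootedGauge σ := by
  obtain ⟨σ, hσ, h⟩ := exists_sign_of_condC2 hG hC
  have hs : ∀ i, σ i * σ i = 1 := fun i => by rcases hσ i with h | h <;> simp [h]
  refine ⟨fun i => σ i, isRootedGauge_iff.2 ⟨fun i => hσ i, fun i j => ?_⟩⟩
  linear_combination (-σ i * σ j) * h i j i.2 - |G.weight i j| * (σ j * σ j * hs i + hs j)

theorem laplacianNrAddB_eq_submatrix :
    G.laplacianNrAddB = G.laplacian.submatrix Subtype.val Subtype.val := by
  ext i j
  rcases eq_or_ne j i with rfl | hij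
  · simp only [laplacianNrAddB, laplacian, nonRootedPart, induce, weightRnr, Matrix.add_apply,
      of_apply, if_true, diagonal_apply_eq, submatrix_apply]
    rw [add_comm]
    exact Fintype.sum_subtype_add_sum_subtype G.IsRooted fun k => |G.weight j k|
  · have : (j : V) ≠ i := fun h => hij (Subtype.ext h)
    simp [laplacianNrAddB, laplacian, nonRootedPart, induce, hij, hij.symm, this]

theorem det_laplacianNrAddB_ne_zero (hG : G.QuasiStronglyConnected) :
    G.laplacianNrAddB.det ≠ 0 := by
  obtain ⟨r, hr⟩ := hG
  rw [laplacianNrAddB_eq_submatrix]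
  exact det_laplacian_submatrix_ne_zero hr (not_not.2 hr)

variable (G) in
/-- The vector that spans the kernel of the Laplacian matrix, for a gauge transformation with
diagonal `σ`. -/
noncomputable def kernelVector (σ : G.Rooted → ℝ) (i : V) : ℝ :=
  if h : G.IsRooted i then σ ⟨i, h⟩ else -((G.Phi σ ⟨i, h⟩).det / G.laplacianNrAddB.det)

theorem kernelVector_rooted (σ : G.Rooted → ℝ) (i : G.Rooted) : G.kernelVector σ i = σ i := by
  simp [kernelVector, i.2]

theorem kernelVector_nonRooted (σ : G.Rooted → ℝ) (j : G.NonRooted) :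
    G.kernelVector σ j = -((G.Phi σ j).det / G.laplacianNrAddB.det) := by
  simp [kernelVector, j.2]

theorem IsRootedGauge.mul_self {σ : G.Rooted → ℝ} (hσ : G.IsRootedGauge σ) (i : G.Rooted) :
    σ i * σ i = 1 := by
  rcases hσ.1 i with h | h <;> simp [h]

theorem IsRootedGauge.laplacian_mulVec_kernelVector {σ : G.Rooted → ℝ} (hσ : G.IsRootedGauge σ)
    (hG : G.QuasiStronglyConnected) : G.laplacian *ᵥ G.kernelVector σ = 0 := by
  ext i
  by_cases hi : G.IsRooted i
  · rw [laplacian_mulVec_apply]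
    refine Finset.sum_eq_zero fun k _ => ?_
    by_cases hk : G.IsRooted k
    · have h := (isRootedGauge_iff.1 hσ).2 ⟨i, hi⟩ ⟨k, hk⟩
      have h1 := hσ.mul_self ⟨i, hi⟩
      simp only at h
      simp only [kernelVector, hi, hk, dif_pos]
      rw [h]
      linear_combination (G.weight i k * σ ⟨k, hk⟩) * h1
    · simp [weight_eq_zero_of_isRooted hi hk]
  -- The non-rooted rows form a square system, solved by Cramer's rule; the minus sign in `Phi`
  -- offsets the one in `kernelVector`.
  · have hM : G.laplacianNrAddB *ᵥ (fun j => G.kernelVector σ j) = G.weightRnr *ᵥ σ := by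
      have e : (fun j : G.NonRooted => G.kernelVector σ j) =
          -(G.laplacianNrAddB.det⁻¹ • cramer G.laplacianNrAddB (-(G.weightRnr *ᵥ σ))) := by
        ext j
        rw [kernelVector_nonRooted, Pi.neg_apply, Pi.smul_apply, cramer_apply, Phi, smul_eq_mul,
          div_eq_inv_mul]
      rw [e, mulVec_neg, mulVec_smul, mulVec_cramer, smul_smul,
        inv_mul_cancel₀ (det_laplacianNrAddB_ne_zero hG), one_smul, neg_neg]
    have h := congrFun hM ⟨i, hi⟩
    rw [laplacianNrAddB_eq_submatrix] at h
    simp only [mulVec, dotProduct, submatrix_apply, weightRnr] at h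
    rw [mulVec, dotProduct, ← Fintype.sum_subtype_add_sum_subtype G.IsRooted, h,
      ← Finset.sum_add_distrib]
    refine Finset.sum_eq_zero fun k _ => ?_
    have hki : (k : V) ≠ i := fun h => hi (h ▸ k.2)
    rw [kernelVector_rooted]
    simp [laplacian, hki]

theorem IsRootedGauge.eq_smul_kernelVector {σ : G.Rooted → ℝ} (hσ : G.IsRootedGauge σ)
    {u : V → ℝ} (hu : G.laplacian *ᵥ u = 0) (r : G.Rooted) :
    u = (u r * σ r) • G.kernelVector σ := by
  rw [← sub_eq_zero]
  refine eq_zero_of_laplacian_mulVec_eq_zero (G := G) (P := fun i : V => i = r) r.2 rfl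
    ?_ fun i _ => ?_
  · rintro i rfl
    have := hσ.mul_self r
    simp only [Pi.sub_apply, Pi.smul_apply, kernelVector_rooted, smul_eq_mul]
    linear_combination -u r * this
  · rw [mulVec_sub, mulVec_smul, hu, hσ.laplacian_mulVec_kernelVector ⟨r, r.2⟩]
    simp

/-- The left kernel vector, supported on the rooted nodes, whose entries are up to signs the
minors of the Laplacian matrix. -/
theorem IsRootedGauge.exists_leftKernel {σ : G.Rooted → ℝ} (hσ : G.IsRootedGauge σ)
    (r : G.Rooted) : ∃ u : V → ℝ, u ᵥ* G.laplacian = 0 ∧ (∀ j, ¬ G.IsRooted j → u j = 0) ∧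
      ∀ k : G.Rooted, u k = σ k * G.laplacianMinor k := by
  have hv := hσ.laplacian_mulVec_kernelVector ⟨r, r.2⟩
  have hr1 := hσ.mul_self r
  have hdet : G.laplacian.det = 0 := exists_mulVec_eq_zero_iff.1 ⟨_, fun h => by
    have := congrFun h r
    rw [kernelVector_rooted] at this
    simp [this] at hr1, hv⟩
  -- As `det L = 0`, `adj L * L = 0`: rows of the adjugate are left kernel vectors.
  have hleft : (fun j => σ r * G.laplacian.adjugate r j) ᵥ* G.laplacian = 0 := by
    ext j
    have := congrFun (congrFun (adjugate_mul G.laplacian) r) j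
    rw [hdet, zero_smul, mul_apply] at this
    simp only [vecMul, dotProduct, mul_assoc, ← Finset.mul_sum, this]
    simp
  refine ⟨fun j => σ r * G.laplacian.adjugate r j, hleft, ?_, fun k => ?_⟩
  · set u : V → ℝ := fun j => σ r * G.laplacian.adjugate r j with hu
    have h : (fun j : G.NonRooted => u j) = 0 := by
      refine eq_zero_of_vecMul_eq_zero (det_laplacianNrAddB_ne_zero (G := G) ⟨r, r.2⟩) ?_
      ext j
      have e := congrFun hleft j
      rw [vecMul, dotProduct, ← Fintype.sum_subtype_add_sum_subtype G.IsRooted] at e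
      rw [Finset.sum_eq_zero (s := (Finset.univ : Finset G.Rooted)), zero_add] at e
      · rw [laplacianNrAddB_eq_submatrix]
        simpa [vecMul, dotProduct] using e
      · intro i _
        have hij : (j : V) ≠ i := fun h => j.2 (h ▸ i.2)
        simp [laplacian, hij, weight_eq_zero_of_isRooted i.2 j.2]
    exact fun j hj => congrFun h ⟨j, hj⟩
  -- Column `k` of the adjugate is a multiple of `kernelVector`, which relates its entry `r` to its
  -- diagonal entry, the minor at `k`.
  · have hcol : G.laplacian *ᵥ (fun i => G.laplacian.adjugate i k) = 0 := by
      ext i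
      have := congrFun (congrFun (mul_adjugate G.laplacian) i) k
      rw [hdet, zero_smul, mul_apply] at this
      exact this
    have h1 := congrFun (hσ.eq_smul_kernelVector hcol r) k
    simp only [Pi.smul_apply, kernelVector_rooted, smul_eq_mul] at h1
    rw [laplacianMinor, ← adjugate_self_eq_det_submatrix, h1]
    have hk1 := hσ.mul_self k
    linear_combination (-G.laplacian.adjugate r k * σ r) * hk1

/-- The left kernel vector `u` annihilates the range of `L`, so pairing with it isolates the
coefficient of `kernelVector`. Were the sum of minors zero, `u` would annihilate every vector,
although its entry at a root is nonzero. -/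
theorem IsRootedGauge.sum_laplacianMinor_ne_zero_and_exists_eq_add {σ : G.Rooted → ℝ}
    (hσ : G.IsRootedGauge σ) (hG : G.QuasiStronglyConnected) : ∑ i : G.Rooted, G.laplacianMinor i ≠ 0 ∧
      ∀ x : V → ℝ, ∃ w, x = G.rootedAverage σ x • G.kernelVector σ + G.laplacian *ᵥ w := by
  obtain ⟨r, hr⟩ := hG
  have : Nonempty V := ⟨r⟩
  obtain ⟨u, hu, hu0, huσ⟩ := hσ.exists_leftKernel ⟨r, hr⟩
  have hdot : ∀ x : V → ℝ, u ⬝ᵥ x = ∑ k : G.Rooted, σ k * G.laplacianMinor k * x k := by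
    intro x
    rw [dotProduct, ← Fintype.sum_subtype_add_sum_subtype G.IsRooted,
      Finset.sum_eq_zero (s := (Finset.univ : Finset G.NonRooted)) fun j _ => by
        rw [hu0 j j.2, zero_mul], add_zero]
    exact Finset.sum_congr rfl fun k _ => by rw [huσ k]
  have hdotv : u ⬝ᵥ G.kernelVector σ = ∑ k : G.Rooted, G.laplacianMinor k := by
    rw [hdot]
    refine Finset.sum_congr rfl fun k _ => ?_
    have := hσ.mul_self k
    rw [kernelVector_rooted]
    linear_combination G.laplacianMinor k * this
  have hdec : ∀ x : V → ℝ, ∃ α : ℝ, ∃ w, x = α • G.kernelVector σ + G.laplacian *ᵥ w ∧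
      u ⬝ᵥ x = α * ∑ k : G.Rooted, G.laplacianMinor k := by
    intro x
    obtain ⟨y, w, hy, rfl⟩ := G.exists_eq_add_laplacian_mulVec x
    refine ⟨_, w, by rw [← hσ.eq_smul_kernelVector hy ⟨r, hr⟩], ?_⟩
    rw [dotProduct_add, dotProduct_mulVec, hu, zero_dotProduct, add_zero, ← hdotv,
      ← smul_eq_mul, ← dotProduct_smul, ← hσ.eq_smul_kernelVector hy ⟨r, hr⟩]
  have hne : ∑ k : G.Rooted, G.laplacianMinor k ≠ 0 := by
    intro h
    obtain ⟨α, w, -, hα⟩ := hdec (Pi.single r 1)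
    rw [h, mul_zero, dotProduct_single_one] at hα
    have h1 := huσ ⟨r, hr⟩
    rw [hα] at h1
    have h2 := hσ.mul_self ⟨r, hr⟩
    rcases mul_eq_zero.1 h1.symm with h3 | h3
    · simp [h3] at h2
    · exact laplacianMinor_ne_zero hr h3
  refine ⟨hne, fun x => ?_⟩
  obtain ⟨α, w, hx, hα⟩ := hdec x
  have : G.rootedAverage σ x = α := by
    rw [rootedAverage, ← hdot, hα, mul_div_cancel_right₀ _ hne]
  exact ⟨w, by rw [this, ← hx]⟩

theorem IsRootedGauge.tendsto {σ : G.Rooted → ℝ} (hσ : G.IsRootedGauge σ)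
    (hG : G.QuasiStronglyConnected) {x : ℝ → V → ℝ} (hx : G.IsTrajectory x) :
    Tendsto x atTop (𝓝 (G.rootedAverage σ (x 0) • G.kernelVector σ)) := by
  obtain ⟨w, hw⟩ := (hσ.sum_laplacianMinor_ne_zero_and_exists_eq_add hG).2 (x 0)
  have : Nonempty V := hG.nonempty
  exact hx.tendsto (by rw [mulVec_smul, hσ.laplacian_mulVec_kernelVector hG, smul_zero]) hw

end Gauge

end SignedDigraph

theorem theorem2 {V : Type*} [Fintype V] [DecidableEq V] (G : SignedDigraph V)
    [DecidablePred G.IsRooted] (hG : G.QuasiStronglyConnected) :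
    (G.CondC1 ∨ G.CondC2 →
      (∃ σ : G.Rooted → ℝ, G.IsRootedGauge σ) ∧
      (∑ i : G.Rooted, G.laplacianMinor i) ≠ 0 ∧
      G.laplacianNrAddB.det ≠ 0 ∧
      ∀ σ : G.Rooted → ℝ, G.IsRootedGauge σ →
        ∀ x : ℝ → V → ℝ, G.IsTrajectory x →
          (∀ i : G.Rooted,
            Tendsto (fun t => x t i) atTop (𝓝 (G.rootedAverage σ (x 0) * σ i))) ∧
          (∀ j : G.NonRooted,
            Tendsto (fun t => x t j) atTop
              (𝓝 (-(G.rootedAverage σ (x 0) * ((G.Phi σ j).det / G.laplacianNrAddB.det)))))) ∧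
    (G.CondC3 → G.StateStable) := by
  refine ⟨fun h => ?_, SignedDigraph.stateStable_of_condC3⟩
  -- Without rooted cycles, C2 holds vacuously.
  have hC : G.CondC2 := h.elim (fun h l k hk => absurd ⟨l, k, hk⟩ h) id
  obtain ⟨σ, hσ⟩ := hC.exists_isRootedGauge hG
  refine ⟨⟨σ, hσ⟩, (hσ.sum_laplacianMinor_ne_zero_and_exists_eq_add hG).1,
    SignedDigraph.det_laplacianNrAddB_ne_zero hG, fun τ hτ x hx => ?_⟩
  have hlim := tendsto_pi_nhds.1 (hτ.tendsto hG hx)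
  refine ⟨fun i => ?_, fun j => ?_⟩
  · simpa [SignedDigraph.kernelVector_rooted] using hlim i
  · simpa [SignedDigraph.kernelVector_nonRooted] using hlim j
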